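/- Let $(A,\mathfrak m)$ be a Noetherian local ring, let $G=\bigoplus_{i\ge 0}\mathfrak m^i/\mathfrak m^{i+1}$ be its associated graded ring, and let $\mathfrak M=\bigoplus_{i\ge 1}\mathfrak m^i/\mathfrak m^{i+1}$ be the homogeneous maximal ideal of $G$. Suppose that $\operatorname{depth} G=1$, that is, the supremum of the lengths of $G$-regular sequences in $\mathfrak M$ is $1$. Let $x^*\in G_1=\mathfrak m/\mathfrak m^2$ be a nonzerodivisor of $G$ and put $\overline G=G/x^*G$, with the induced grading. Let $H^0_{\mathfrak M}(\overline G)$ be the submodule of the elements of $\overline G$ annihilated by a power of $\mathfrak M$, and let $\operatorname{Soc}(H^0_{\mathfrak M}(\overline G))$ be the submodule of its elements annihilated by $\mathfrak M$. Let $n\ge 0$ be an integer such that $[\operatorname{Soc}(H^0_{\mathfrak M}(\overline G))]_k=0$ for all $k<n$. Then for every integer $\ell$ with $1\le \ell\le n$ the ideal $\mathfrak m^\ell$ has the strong Rees property: it is $\mathfrak m$-primary, and $\mu(J)<\mu(\mathfrak m^\ell)$ for every ideal $J\supsetneq\mathfrak m^\ell$ of $A$, where $\mu$ denotes the minimal number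 of generators. -/

import Mathlib

open scoped DirectSum

noncomputable section

universe u

namespace AssocGraded

section Construction

variable {A : Type u} [CommRing A] (I : Ideal A)

/-- The `n`-th graded piece `I ^ n / I ^ (n + 1)`. -/
def Piece (n : ℕ) : Type u :=
  ↥(I ^ n) ⧸ (I ^ (n + 1)).submoduleOf (I ^ n)

instance (n : ℕ) : AddCommGroup (Piece I n) :=
  inferInstanceAs (AddCommGroup (↥(I ^ n) ⧸ (I ^ (n + 1)).submoduleOf (I ^ n)))

instance (n : ℕ) : Module A (Piece I n) :=
  inferInstanceAs (Module A (↥(I ^ n) ⧸ (I ^ (n + 1)).submoduleOf (I ^ n)))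

/-- The class in `I ^ n / I ^ (n + 1)` of an element of `I ^ n`. -/
def mk (n : ℕ) : ↥(I ^ n) →ₗ[A] Piece I n :=
  ((I ^ (n + 1)).submoduleOf (I ^ n)).mkQ

theorem mk_surjective (n : ℕ) : Function.Surjective (mk I n) :=
  Submodule.mkQ_surjective _

theorem mk_eq_zero {n : ℕ} (a : ↥(I ^ n)) : mk I n a = 0 ↔ (a : A) ∈ I ^ (n + 1) :=
  Submodule.Quotient.mk_eq_zero _

/-- The product `I ^ i × I ^ j → I ^ (i + j)`. -/
def mulAux (i j : ℕ) : ↥(I ^ i) →ₗ[A] ↥(I ^ j) →ₗ[A] ↥(I ^ (i + j)) :=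
  LinearMap.mk₂ A
    (fun a b => ⟨(a : A) * (b : A), by rw [pow_add]; exact Ideal.mul_mem_mul a.2 b.2⟩)
    (fun a b c => Subtype.ext (add_mul (a : A) b c))
    (fun r a b => Subtype.ext (mul_assoc r (a : A) b))
    (fun a b c => Subtype.ext (mul_add (a : A) b c))
    (fun r a b => Subtype.ext (mul_left_comm (a : A) r b))

/-- The product of graded pieces, induced by the product of `A`. -/
def pieceMul (i j : ℕ) : Piece I i →ₗ[A] Piece I j →ₗ[A] Piece I (i + j) :=
  Submodule.liftQ _
    (LinearMap.flip (Submodule.liftQ _ (LinearMap.flip ((mulAux I i j).compr₂ (mk I (i + j))))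
      (by
        intro b hb
        ext a
        have hb' : (b : A) ∈ I ^ (j + 1) := hb
        refine (mk_eq_zero I _).2 ?_
        change (a : A) * (b : A) ∈ _
        rw [add_assoc, pow_add]
        exact Ideal.mul_mem_mul a.2 hb')))
    (by
      intro a ha
      have ha' : (a : A) ∈ I ^ (i + 1) := ha
      refine LinearMap.ext fun y => ?_
      obtain ⟨b, rfl⟩ := mk_surjective I j y
      refine (mk_eq_zero I _).2 ?_
      change (a : A) * (b : A) ∈ _
      rw [add_right_comm, pow_add]
      exact Ideal.mul_mem_mul ha' b.2)

theorem pieceMul_mk {i j : ℕ} (a : ↥(I ^ i)) (b : ↥(I ^ j)) :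
    pieceMul I i j (mk I i a) (mk I j b) = mk I (i + j) (mulAux I i j a b) :=
  rfl

theorem gradedMonoid_mk_eq {i j : ℕ} (h : i = j) (a : ↥(I ^ i)) (b : ↥(I ^ j))
    (hab : (a : A) = b) :
    (GradedMonoid.mk i (mk I i a) : GradedMonoid (Piece I)) = GradedMonoid.mk j (mk I j b) := by
  subst h
  rw [Subtype.ext hab]

/-- The class of `1` in degree zero. -/
def pieceOne : Piece I 0 := mk I 0 ⟨1, by simp⟩

instance : GradedMonoid.GMul (Piece I) where
  mul {i j} a b := pieceMul I i j a b

instance : GradedMonoid.GOne (Piece I) where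
  one := pieceOne I

instance : DirectSum.GCommRing (Piece I) where
  mul_zero {i j} a := map_zero (pieceMul I i j a)
  zero_mul {i j} b := LinearMap.map_zero₂ (pieceMul I i j) b
  mul_add {i j} a b c := map_add (pieceMul I i j a) b c
  add_mul {i j} a b c := LinearMap.map_add₂ (pieceMul I i j) a b c
  one_mul := by
    rintro ⟨i, a⟩
    obtain ⟨a, rfl⟩ := mk_surjective I i a
    exact gradedMonoid_mk_eq I (zero_add i) (mulAux I 0 i ⟨1, by simp⟩ a) a (one_mul (a : A))
  mul_one := by
    rintro ⟨i, a⟩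
    obtain ⟨a, rfl⟩ := mk_surjective I i a
    exact gradedMonoid_mk_eq I (add_zero i) (mulAux I i 0 a ⟨1, by simp⟩) a (mul_one (a : A))
  mul_assoc := by
    rintro ⟨i, a⟩ ⟨j, b⟩ ⟨k, c⟩
    obtain ⟨a, rfl⟩ := mk_surjective I i a
    obtain ⟨b, rfl⟩ := mk_surjective I j b
    obtain ⟨c, rfl⟩ := mk_surjective I k c
    exact gradedMonoid_mk_eq I (add_assoc i j k) (mulAux I (i + j) k (mulAux I i j a b) c)
      (mulAux I i (j + k) a (mulAux I j k b c)) (mul_assoc (a : A) b c)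
  mul_comm := by
    rintro ⟨i, a⟩ ⟨j, b⟩
    obtain ⟨a, rfl⟩ := mk_surjective I i a
    obtain ⟨b, rfl⟩ := mk_surjective I j b
    exact gradedMonoid_mk_eq I (add_comm i j) (mulAux I i j a b) (mulAux I j i b a)
      (mul_comm (a : A) b)
  natCast n := n • pieceOne I
  natCast_zero := zero_smul _ _
  natCast_succ n := succ_nsmul _ _
  intCast n := n • pieceOne I
  intCast_ofNat n := natCast_zsmul _ _
  intCast_negSucc_ofNat n := negSucc_zsmul _ _

end Construction

end AssocGraded

/-- The associated graded ring `G(I) = ⨁ₙ I ^ n / I ^ (n + 1)`. -/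
abbrev AssocGraded {A : Type u} [CommRing A] (I : Ideal A) : Type u :=
  ⨁ n, AssocGraded.Piece I n

namespace AssocGraded

variable {A : Type u} [CommRing A] (I : Ideal A)

/-- The ideal `G₊` of `G(I)` generated by the homogeneous elements of positive degree. When `I` is
a maximal ideal, `G(I)₀ = A / I` is a field and this is the homogeneous maximal ideal of `G(I)`;
it is also the extension to `G(I)` of the ideal `I R + R₊` of the Rees algebra `R = ⨁ₙ I ^ n tⁿ`. -/
def irrelevant : Ideal (AssocGraded I) :=
  Ideal.span {g | ∃ n, 0 < n ∧ ∃ a : Piece I n, g = DirectSum.of (Piece I) n a}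

end AssocGraded

/-- The depth of a module `N` with respect to an ideal `I`: the supremum of the lengths of the
`N`-regular sequences contained in `I`. -/
def Ideal.moduleDepth {R : Type*} [CommRing R] (I : Ideal R) (N : Type*) [AddCommGroup N]
    [Module R N] : ℕ∞ :=
  ⨆ (rs : List R) (_ : (∀ r ∈ rs, r ∈ I) ∧ RingTheory.Sequence.IsRegular N rs), (rs.length : ℕ∞)

/-- The zeroth local cohomology `H⁰_I(N)`, i.e. the submodule of the elements of `N` that are
annihilated by some power of `I`. -/
def Ideal.zerothLocalCohomology {R : Type*} [CommRing R] (I : Ideal R) (N : Type*)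
    [AddCommGroup N] [Module R N] : Submodule R N where
  carrier := {z | ∃ t : ℕ, ∀ r ∈ I ^ t, r • z = 0}
  zero_mem' := ⟨0, fun _ _ => smul_zero _⟩
  add_mem' := by
    rintro a b ⟨s, hs⟩ ⟨t, ht⟩
    refine ⟨s + t, fun r hr => ?_⟩
    rw [smul_add, hs r (Ideal.pow_le_pow_right (Nat.le_add_right s t) hr),
      ht r (Ideal.pow_le_pow_right (Nat.le_add_left t s) hr), add_zero]
  smul_mem' := by
    rintro c z ⟨t, ht⟩
    exact ⟨t, fun r hr => by rw [smul_comm, ht r hr, smul_zero]⟩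

/-- The socle of a module `N` with respect to an ideal `I` (in use, the homogeneous
maximal ideal of a graded ring): the elements of `N` annihilated by `I`. -/
def Ideal.moduleSocle {R : Type*} [CommRing R] (I : Ideal R) (N : Type*)
    [AddCommGroup N] [Module R N] : Submodule R N :=
  Submodule.torsionBySet R N (I : Set R)

namespace AssocGraded

variable {A : Type u} [CommRing A] (I : Ideal A)

/-- The quotient `G(I) / g G(I)`. -/
abbrev QuotientBy (g : AssocGraded I) : Type u :=
  AssocGraded I ⧸ Ideal.span {g}

/-- The component of degree `n` of `G(I) / g G(I)`, i.e. the image of `I ^ n / I ^ (n + 1)`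
(used for homogeneous `g`, when these components form a grading). -/
def quotientPiece (g : AssocGraded I) (n : ℕ) : AddSubgroup (QuotientBy I g) :=
  (DirectSum.of (Piece I) n).range.map (Ideal.Quotient.mk (Ideal.span {g})).toAddMonoidHom

/-- The component `[Soc H⁰_M(G(I) / g G(I))]ₙ` of degree `n` of the socle of the zeroth local
cohomology of `G(I) / g G(I)`, where `M = G(I)₊`. -/
def socleComponent (g : AssocGraded I) (n : ℕ) :
    AddSubgroup ((irrelevant I).zerothLocalCohomology (QuotientBy I g)) :=
  ((irrelevant I).moduleSocle
      ((irrelevant I).zerothLocalCohomology (QuotientBy I g))).toAddSubgroup ⊓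
    (quotientPiece I g n).comap
      ((irrelevant I).zerothLocalCohomology (QuotientBy I g)).subtype.toAddMonoidHom

end AssocGraded

/-- An ideal `I` of a local ring `(A, m)` has the strong Rees property if it is `m`-primary and every
ideal `J` that properly contains `I` satisfies `μ(J) < μ(I)`, where `μ` is the minimal
number of generators. -/
def Ideal.HasStrongReesProperty {A : Type u} [CommRing A] [IsLocalRing A] (I : Ideal A) : Prop :=
  (I.IsPrimary ∧ I.radical = IsLocalRing.maximalIdeal A) ∧
    ∀ J : Ideal A, I < J → J.spanFinrank < I.spanFinrank

end

/-! Write `m` for the maximal ideal. Since the form of `x` is a nonzerodivisor, `x` cancels modulo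
powers of `m`; in particular `m ^ (l + 1) : x = m ^ l`, so `m ^ l` is `m`-full. Suppose `J` strictly
contains `m ^ l` and has at least as many generators. Comparing colengths forces `m J ⊆ x J + m ^ (l
+ 1)` (`IsLocalRing.maximalIdeal_mul_le_of_spanFinrank_le`). The socle hypothesis, translated to `A`
by `mem_span_sup_of_socleComponent_eq_bot`, then pushes `J` from `m ^ k` into `m ^ (k + 1)` for each
`k < l` (`Ideal.le_pow_succ_of_mul_le`). Hence `J ⊆ m ^ l`, a contradiction. -/

namespace AssocGraded

/-! ### Initial forms, cancellation and the socle. -/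

variable {A : Type*} [CommRing A] {I : Ideal A}

/-- The homogeneous element of degree `i` of the associated graded ring that is represented by an
element `a` of `I ^ i`. -/
def form (I : Ideal A) (i : ℕ) (a : A) (ha : a ∈ I ^ i) : AssocGraded I :=
  DirectSum.of (Piece I) i (mk I i ⟨a, ha⟩)

theorem form_congr {i j : ℕ} {a b : A} (hij : i = j) (hab : a = b) (ha : a ∈ I ^ i)
    (hb : b ∈ I ^ j) : form I i a ha = form I j b hb := by
  subst hij hab
  rfl

theorem form_mul {i j : ℕ} {a b : A} (ha : a ∈ I ^ i) (hb : b ∈ I ^ j) (hab : a * b ∈ I ^ (i + j)) :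
    form I i a ha * form I j b hb = form I (i + j) (a * b) hab :=
  DirectSum.of_mul_of _ _

theorem form_add {i : ℕ} {a b : A} (ha : a ∈ I ^ i) (hb : b ∈ I ^ i) (hab : a + b ∈ I ^ i) :
    form I i (a + b) hab = form I i a ha + form I i b hb := by
  unfold form
  rw [← map_add, ← map_add]
  rfl

theorem form_eq_zero {i : ℕ} {a : A} (ha : a ∈ I ^ i) : form I i a ha = 0 ↔ a ∈ I ^ (i + 1) := by
  unfold form
  rw [map_eq_zero_iff _ (DirectSum.of_injective i), mk_eq_zero]

/-- Every homogeneous component of a multiple of the form of degree one of `x` is represented by a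
multiple of `x`. -/
theorem exists_dvd_apply_form_mul {x : A} (hx : x ∈ I ^ 1) (g : AssocGraded I) (k : ℕ) :
    ∃ a : ↥(I ^ k), x ∣ (a : A) ∧ (form I 1 x hx * g) k = mk I k a := by
  induction g using DirectSum.induction_on with
  | zero => exact ⟨0, dvd_zero _, by simp⟩
  | of j b =>
    obtain ⟨b, rfl⟩ := mk_surjective I j b
    have hxb : x * b ∈ I ^ (1 + j) := by
      rw [pow_add]
      exact Ideal.mul_mem_mul hx b.2
    have h : form I 1 x hx * DirectSum.of (Piece I) j (mk I j b) = form I (1 + j) (x * b) hxb :=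
      form_mul hx b.2 hxb
    rw [h]
    by_cases hk : 1 + j = k
    · subst hk
      exact ⟨⟨x * b, hxb⟩, dvd_mul_right _ _, DirectSum.of_eq_same _ _⟩
    · exact ⟨0, dvd_zero _, by rw [map_zero]; exact DirectSum.of_eq_of_ne _ _ _ (Ne.symm hk)⟩
  | add g h hg hh =>
    obtain ⟨a, hxa, ha⟩ := hg
    obtain ⟨b, hxb, hb⟩ := hh
    exact ⟨a + b, dvd_add hxa hxb, by rw [mul_add, DirectSum.add_apply, ha, hb, map_add]⟩

theorem mem_span_sup_of_form_mem_span {x a : A} {k : ℕ} (hx : x ∈ I ^ 1) (ha : a ∈ I ^ k)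
    (h : form I k a ha ∈ Ideal.span {form I 1 x hx}) : a ∈ Ideal.span {x} ⊔ I ^ (k + 1) := by
  obtain ⟨g, hg⟩ := Ideal.mem_span_singleton'.1 h
  obtain ⟨b, hxb, hb⟩ := exists_dvd_apply_form_mul hx g k
  have hab : mk I k (⟨a, ha⟩ - b) = 0 := by
    rw [map_sub, ← hb, mul_comm, hg, sub_eq_zero]
    exact (DirectSum.of_eq_same k _).symm
  rw [mk_eq_zero] at hab
  rw [← add_sub_cancel (b : A) a]
  exact Submodule.add_mem_sup (Ideal.mem_span_singleton.2 hxb) hab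

/-- Cancellation of `x` modulo powers of `I`, when its form of degree one is a nonzerodivisor. -/
theorem mem_pow_of_mul_mem_pow {x : A} (hx : x ∈ I ^ 1)
    (hreg : form I 1 x hx ∈ nonZeroDivisors (AssocGraded I)) {a : A} (k : ℕ)
    (h : x * a ∈ I ^ (k + 1)) : a ∈ I ^ k := by
  induction k with
  | zero => simp
  | succ k ih =>
    have ha : a ∈ I ^ k := ih (Ideal.pow_le_pow_right (by omega) h)
    rw [← form_eq_zero ha]
    -- The product of the two forms lives in degree `k + 1` and vanishes because `x * a ∈ I ^ (k +
    -- 2)`.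
    refine (mem_nonZeroDivisors_iff.1 hreg).1 _ ?_
    have hxa : x * a ∈ I ^ (1 + k) := Ideal.pow_le_pow_right (by omega) h
    rw [form_mul hx ha hxa, form_eq_zero]
    rwa [add_comm 1 k]

/-- If `r * a = x * c + d` with `d ∈ I ^ (k + 2)`, cancellation puts `c` in `I ^ k`. So modulo
higher order `b * a` is `x` times an element of the expected order, and this passes to forms. -/
theorem form_mul_mem_span {x a : A} (hx : x ∈ I ^ 1)
    (hreg : form I 1 x hx ∈ nonZeroDivisors (AssocGraded I)) {k : ℕ} (ha : a ∈ I ^ k)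
    (hann : ∀ r ∈ I, r * a ∈ Ideal.span {x} ⊔ I ^ (k + 2)) {i : ℕ} {b : A}
    (hb : b ∈ I ^ (i + 1)) :
    form I (i + 1) b hb * form I k a ha ∈ Ideal.span {form I 1 x hx} := by
  have key : ∃ c ∈ I ^ (i + k), b * a - x * c ∈ I ^ (i + k + 2) := by
    rw [pow_succ] at hb
    refine Submodule.mul_induction_on hb (fun s hs r hr => ?_) ?_
    · obtain ⟨y, hy, d, hd, hyd⟩ := Submodule.mem_sup.1 (hann r hr)
      obtain ⟨c, rfl⟩ := Ideal.mem_span_singleton.1 hy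
      have hra : r * a ∈ I ^ (k + 1) := by
        rw [pow_succ']
        exact Ideal.mul_mem_mul hr ha
      have hc : c ∈ I ^ k := by
        refine mem_pow_of_mul_mem_pow hx hreg k ?_
        rw [eq_sub_of_add_eq hyd]
        exact sub_mem hra (Ideal.pow_le_pow_right (by omega) hd)
      refine ⟨s * c, by rw [pow_add]; exact Ideal.mul_mem_mul hs hc, ?_⟩
      have : s * r * a - x * (s * c) = s * d := by linear_combination (-s) * hyd
      rw [this, add_assoc, pow_add]
      exact Ideal.mul_mem_mul hs hd
    · rintro b b' ⟨c, hc, h⟩ ⟨c', hc', h'⟩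
      refine ⟨c + c', add_mem hc hc', ?_⟩
      have : (b + b') * a - x * (c + c') = (b * a - x * c) + (b' * a - x * c') := by ring
      rw [this]
      exact add_mem h h'
  obtain ⟨c, hc, h⟩ := key
  have hba : b * a ∈ I ^ (i + 1 + k) := by
    rw [pow_add]
    exact Ideal.mul_mem_mul hb ha
  have hxc : x * c ∈ I ^ (1 + (i + k)) := by
    rw [pow_add]
    exact Ideal.mul_mem_mul hx hc
  have hxc' : x * c ∈ I ^ (i + 1 + k) := by convert hxc using 2; omega
  have hd : b * a - x * c ∈ I ^ (i + 1 + k) := sub_mem hba hxc'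
  rw [Ideal.mem_span_singleton, form_mul hb ha hba]
  refine ⟨form I (i + k) c hc, ?_⟩
  rw [form_mul hx hc hxc, form_congr rfl (add_sub_cancel (x * c) (b * a)).symm hba
    (by rwa [add_sub_cancel]), form_add hxc' hd,
    (form_eq_zero hd).2 (by convert h using 2; omega), add_zero]
  exact form_congr (by omega) rfl _ _

/-- The vanishing of a component of the socle of `H⁰(G(I) / x* G(I))`, in terms of the ring. -/
theorem mem_span_sup_of_socleComponent_eq_bot {x : A} (hx : x ∈ I ^ 1)
    (hreg : form I 1 x hx ∈ nonZeroDivisors (AssocGraded I)) {k : ℕ}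
    (hsoc : socleComponent I (form I 1 x hx) k = ⊥) {a : A} (ha : a ∈ I ^ k)
    (hann : ∀ r ∈ I, r * a ∈ Ideal.span {x} ⊔ I ^ (k + 2)) :
    a ∈ Ideal.span {x} ⊔ I ^ (k + 1) := by
  refine mem_span_sup_of_form_mem_span hx ha ?_
  let z : QuotientBy I (form I 1 x hx) := Ideal.Quotient.mk _ (form I k a ha)
  have hz : ∀ r ∈ irrelevant I, r • z = 0 := by
    intro r hr
    change Ideal.Quotient.mk _ (r * form I k a ha) = 0
    rw [Ideal.Quotient.eq_zero_iff_mem]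
    refine Submodule.span_induction ?_ ?_ ?_ ?_ hr
    · rintro _ ⟨i, hi, b, rfl⟩
      obtain ⟨b, rfl⟩ := mk_surjective I i b
      obtain ⟨i, rfl⟩ := Nat.exists_eq_add_one.2 hi
      exact form_mul_mem_span hx hreg ha hann b.2
    · rw [zero_mul]
      exact zero_mem _
    · intro r s _ _ h h'
      rw [add_mul]
      exact add_mem h h'
    · intro c r _ h
      rw [smul_eq_mul, mul_assoc]
      exact Ideal.mul_mem_left _ _ h
  have hz' : z ∈ (irrelevant I).zerothLocalCohomology (QuotientBy I (form I 1 x hx)) :=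
    -- A socle element is already killed by the first power, hence lies in `H⁰`.
    ⟨1, by rwa [pow_one]⟩
  have hmem : (⟨z, hz'⟩ : (irrelevant I).zerothLocalCohomology _) ∈
      socleComponent I (form I 1 x hx) k := by
    refine ⟨?_, ?_⟩
    · change _ ∈ Submodule.torsionBySet _ _ _
      rw [Submodule.mem_torsionBySet_iff]
      exact fun r => Subtype.ext (hz r r.2)
    · exact ⟨form I k a ha, ⟨mk I k ⟨a, ha⟩, rfl⟩, rfl⟩
  rw [hsoc, AddSubgroup.mem_bot] at hmem
  exact Ideal.Quotient.eq_zero_iff_mem.1 (congrArg Subtype.val hmem)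

end AssocGraded

/-! ### Pushing an ideal into the next power. -/

section MaximalIdealPowers

variable {A : Type*} [CommRing A]

/-- An ideal `W` inside `I ^ k` with `I W ⊆ x W + I ^ (k + 2)` lies in `I ^ (k + 1)`, if `x` can be
cancelled modulo powers of `I` and the elements of `I ^ j`, `j ≤ k`, that `I` multiplies into
`x A + I ^ (j + 2)` lie in `x A + I ^ (j + 1)`. -/
theorem Ideal.le_pow_succ_of_mul_le {I : Ideal A} {x : A} (hxI : x ∈ I)
    (hcancel : ∀ k a, x * a ∈ I ^ (k + 1) → a ∈ I ^ k) (k : ℕ)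
    (hsoc : ∀ j ≤ k, ∀ a ∈ I ^ j, (∀ r ∈ I, r * a ∈ Ideal.span {x} ⊔ I ^ (j + 2)) →
      a ∈ Ideal.span {x} ⊔ I ^ (j + 1)) (W : Ideal A) (hW : W ≤ I ^ k)
    (hIW : I * W ≤ Ideal.span {x} * W ⊔ I ^ (k + 2)) : W ≤ I ^ (k + 1) := by
  have hWx : ∀ a ∈ W, a ∈ Ideal.span {x} ⊔ I ^ (k + 1) := fun a ha =>
    hsoc k le_rfl a (hW ha) fun r hr =>
      (sup_le_sup_right Ideal.mul_le_left _ : _ ≤ Ideal.span {x} ⊔ I ^ (k + 2))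
        (hIW (Ideal.mul_mem_mul hr ha))
  induction k generalizing W with
  | zero =>
    intro a ha
    -- In degree zero the term `x A` is absorbed, because `x ∈ I`.
    have hxI' : Ideal.span {x} ≤ I ^ (0 + 1) := by
      rwa [Ideal.span_singleton_le_iff_mem, zero_add, pow_one]
    have h := hWx a ha
    rwa [sup_eq_right.2 hxI'] at h
  | succ k ih =>
    have hdec : ∀ a ∈ W, ∃ b ∈ I ^ k, a - x * b ∈ I ^ (k + 2) := by
      intro a ha
      obtain ⟨y, hy, d, hd, rfl⟩ := Submodule.mem_sup.1 (hWx a ha)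
      obtain ⟨b, rfl⟩ := Ideal.mem_span_singleton.1 hy
      refine ⟨b, hcancel k b ?_, by rwa [add_sub_cancel_left]⟩
      rw [← add_sub_cancel_right (x * b) d]
      exact sub_mem (hW ha) (Ideal.pow_le_pow_right (by omega) hd)
    -- Up to `I ^ (k + 2)`, `W` is contained in `x V`. This `V` inherits the hypotheses one degree
    -- lower; once `V ≤ I ^ (k + 1)`, also `W ≤ I ^ (k + 2)`.
    let V : Ideal A := I ^ k ⊓ Submodule.comap (LinearMap.mulLeft A x) (W ⊔ I ^ (k + 2))
    have hVmem : ∀ a ∈ W, ∀ b ∈ I ^ k, a - x * b ∈ I ^ (k + 2) → b ∈ V := by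
      refine fun a ha b hb h => ⟨hb, ?_⟩
      change x * b ∈ W ⊔ I ^ (k + 2)
      rw [← sub_sub_cancel a (x * b)]
      exact sub_mem (Submodule.mem_sup_left ha) (Submodule.mem_sup_right h)
    have hIV : I * V ≤ Ideal.span {x} * V ⊔ I ^ (k + 2) := by
      refine Ideal.mul_le.2 fun r hr b hb => ?_
      obtain ⟨w, hw, e, he, hwe⟩ := Submodule.mem_sup.1 (hb.2 : x * b ∈ W ⊔ I ^ (k + 2))
      rw [LinearMap.mulLeft_apply] at hwe
      obtain ⟨y, hy, f, hf, hyf⟩ := Submodule.mem_sup.1 (hIW (Ideal.mul_mem_mul hr hw))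
      obtain ⟨w', hw', rfl⟩ := Ideal.mem_span_singleton_mul.1 hy
      obtain ⟨b', hb', h⟩ := hdec w' hw'
      have hre : r * e ∈ I ^ (k + 2 + 1) := by
        rw [pow_succ']
        exact Ideal.mul_mem_mul hr he
      have hxh : x * (w' - x * b') ∈ I ^ (k + 2 + 1) := by
        rw [pow_succ']
        exact Ideal.mul_mem_mul hxI h
      -- Multiply by `x`, replace `x * b` by `w` and `w'` by `x * b'`: all errors lie in `I ^ (k +
      -- 3)`, so `x` cancels.
      have hc : r * b - x * b' ∈ I ^ (k + 2) := by
        refine hcancel _ _ ?_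
        have : x * (r * b - x * b') = r * e + f + x * (w' - x * b') := by
          linear_combination (-r) * hwe - hyf
        rw [this]
        exact add_mem (add_mem hre (by convert hf using 1)) hxh
      rw [← add_sub_cancel (x * b') (r * b)]
      exact Submodule.add_mem_sup (Ideal.mul_mem_mul (Ideal.mem_span_singleton_self x)
        (hVmem w' hw' b' hb' h)) hc
    have hV : V ≤ I ^ (k + 1) :=
      ih (fun j hj => hsoc j (by omega)) V inf_le_left hIV fun b hb =>
        hsoc k (by omega) b hb.1 fun r hr =>
          (sup_le_sup_right Ideal.mul_le_left _ : _ ≤ Ideal.span {x} ⊔ I ^ (k + 2))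
            (hIV (Ideal.mul_mem_mul hr hb))
    intro a ha
    obtain ⟨b, hb, h⟩ := hdec a ha
    rw [← add_sub_cancel (x * b) a]
    refine add_mem ?_ h
    rw [pow_succ']
    exact Ideal.mul_mem_mul hxI (hV (hVmem a ha b hb h))

end MaximalIdealPowers

/-! ### Colengths and numbers of generators. -/

section Length

variable {A : Type*} [CommRing A]

/-- The exact sequence `0 → A / (K : x) → A / K → A / (x A + K) → 0`, in terms of lengths. -/
theorem Ideal.length_quotient_eq_add (K L : Ideal A) (x : A) (hL : ∀ a, a ∈ L ↔ x * a ∈ K) :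
    Module.length A (A ⧸ K) =
      Module.length A (A ⧸ L) + Module.length A (A ⧸ (Ideal.span {x} ⊔ K)) := by
  let f : (A ⧸ L) →ₗ[A] A ⧸ K := Submodule.mapQ L K (LinearMap.mulLeft A x) fun a => (hL a).1
  let g : (A ⧸ K) →ₗ[A] A ⧸ (Ideal.span {x} ⊔ K) := Submodule.factor le_sup_right
  refine Module.length_eq_add_of_exact f g ?_ (Submodule.factor_surjective _) ?_
  · rw [injective_iff_map_eq_zero]
    intro a
    obtain ⟨a, rfl⟩ := Submodule.mkQ_surjective L a
    intro h
    exact (Submodule.Quotient.mk_eq_zero L).2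
      ((hL a).2 ((Submodule.Quotient.mk_eq_zero K).1 h))
  · intro b
    obtain ⟨b, rfl⟩ := Submodule.mkQ_surjective K b
    constructor
    · intro h
      obtain ⟨y, hy, c, hc, rfl⟩ := Submodule.mem_sup.1 ((Submodule.Quotient.mk_eq_zero _).1 h)
      obtain ⟨a, rfl⟩ := Ideal.mem_span_singleton.1 hy
      refine ⟨Submodule.mkQ L a, (Submodule.Quotient.eq K).2 ?_⟩
      change x * a - (x * a + c) ∈ K
      rw [sub_add_cancel_left]
      exact neg_mem hc
    · rintro ⟨a, ha⟩
      obtain ⟨a, rfl⟩ := Submodule.mkQ_surjective L a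
      rw [← ha]
      exact (Submodule.Quotient.mk_eq_zero _).2
        (Submodule.mem_sup_left (Ideal.mul_mem_right _ _ (Ideal.mem_span_singleton_self x)))

theorem Ideal.length_quotient_anti {K L : Ideal A} (h : K ≤ L) :
    Module.length A (A ⧸ L) ≤ Module.length A (A ⧸ K) :=
  Module.length_le_of_surjective (Submodule.factor h) (Submodule.factor_surjective h)

/-- The colength is the coheight in the lattice of ideals, which drops strictly where it is finite.
-/
theorem Ideal.eq_of_length_quotient_le {K L : Ideal A} (h : K ≤ L)
    (hfin : Module.length A (A ⧸ L) ≠ ⊤)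
    (hle : Module.length A (A ⧸ K) ≤ Module.length A (A ⧸ L)) : K = L := by
  by_contra hne
  rw [Module.length_quotient] at hfin hle
  rw [Module.length_quotient] at hle
  exact (Order.coheight_strictAnti (lt_of_le_of_ne h hne) (lt_top_iff_ne_top.2 hfin)).not_ge hle

namespace IsLocalRing

variable [IsLocalRing A]

/-- By Nakayama `μ(J)` is the residue field dimension of `J / m J`, which is also its length over
`A`; then use `0 → J / m J → A / m J → A / J → 0`. -/
theorem length_quotient_maximalIdeal_mul (J : Ideal A) (hJ : J.FG) :
    Module.length A (A ⧸ maximalIdeal A * J) = J.spanFinrank + Module.length A (A ⧸ J) := by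
  let _ : Field (A ⧸ maximalIdeal A) := Ideal.Quotient.field _
  have : Module.Finite A J := Module.Finite.iff_fg.2 hJ
  have : Module.Finite (A ⧸ maximalIdeal A) (J ⧸ maximalIdeal A • (⊤ : Submodule A J)) :=
    Module.Finite.of_restrictScalars_finite A _ _
  have hlen : Module.length A (J ⧸ maximalIdeal A • (⊤ : Submodule A J)) = J.spanFinrank := by
    rw [spanFinrank_eq_finrank_quotient J hJ, ← Module.length_eq_finrank]
    exact Module.length_eq_of_surjective Ideal.Quotient.mk_surjective
  have hmem : ∀ a : J, a ∈ maximalIdeal A • (⊤ : Submodule A J) ↔ (a : A) ∈ maximalIdeal A * J := by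
    intro a
    have h : (maximalIdeal A • (⊤ : Submodule A J)).map J.subtype = maximalIdeal A * J := by
      rw [Submodule.map_smul'', Submodule.map_subtype_top, smul_eq_mul]
    rw [← h]
    exact (Function.Injective.mem_set_image J.subtype_injective).symm
  rw [← hlen]
  refine Module.length_eq_add_of_exact
    (Submodule.mapQ _ _ J.subtype fun a ha => (hmem a).1 ha)
    (Submodule.factor Ideal.mul_le_right) ?_ (Submodule.factor_surjective _) ?_
  · rw [injective_iff_map_eq_zero]
    intro a
    obtain ⟨a, rfl⟩ := Submodule.mkQ_surjective _ a
    intro h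
    exact (Submodule.Quotient.mk_eq_zero _).2 ((hmem a).2 ((Submodule.Quotient.mk_eq_zero _).1 h))
  · intro b
    obtain ⟨b, rfl⟩ := Submodule.mkQ_surjective _ b
    constructor
    · intro h
      exact ⟨Submodule.mkQ _ ⟨b, (Submodule.Quotient.mk_eq_zero _).1 h⟩, rfl⟩
    · rintro ⟨a, ha⟩
      obtain ⟨a, rfl⟩ := Submodule.mkQ_surjective _ a
      rw [← ha]
      exact (Submodule.Quotient.mk_eq_zero _).2 a.2

variable [IsNoetherianRing A]

theorem length_quotient_maximalIdeal_pow_ne_top (l : ℕ) :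
    Module.length A (A ⧸ maximalIdeal A ^ l) ≠ ⊤ := by
  induction l with
  | zero =>
    have : Subsingleton (A ⧸ maximalIdeal A ^ 0) := by
      rw [pow_zero, Ideal.one_eq_top]
      exact Ideal.Quotient.subsingleton_iff.2 rfl
    rw [Module.length_eq_zero]
    exact ENat.zero_ne_top
  | succ l ih =>
    rw [pow_succ', length_quotient_maximalIdeal_mul _ (Ideal.fg_of_isNoetherianRing _)]
    exact WithTop.add_ne_top.2 ⟨ENat.natCast_ne_top _, ih⟩

/-- If an `m`-full ideal `I` of finite colength has no more generators than a larger ideal `J`, then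
`m J ⊆ x J + m I`. -/
theorem maximalIdeal_mul_le_of_spanFinrank_le {I J : Ideal A} {x : A} (hx : x ∈ maximalIdeal A)
    (hIJ : I ≤ J) (hfull : ∀ a, x * a ∈ maximalIdeal A * I → a ∈ I)
    (hfin : Module.length A (A ⧸ maximalIdeal A * I) ≠ ⊤)
    (hle : I.spanFinrank ≤ J.spanFinrank) :
    maximalIdeal A * J ≤ Ideal.span {x} * J ⊔ maximalIdeal A * I := by
  set m := maximalIdeal A
  let L : Ideal A := Submodule.comap (LinearMap.mulLeft A x) (m * J)
  have hJL : J ≤ L := fun a ha => Ideal.mul_mem_mul hx ha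
  have hmIJ : m * I ≤ m * J := Ideal.mul_mono_right hIJ
  have hmono : Ideal.span {x} ⊔ m * I ≤ Ideal.span {x} ⊔ m * J := sup_le_sup_left hmIJ _
  have hI₁ := Ideal.length_quotient_eq_add (m * I) I x
    fun a => ⟨fun ha => Ideal.mul_mem_mul hx ha, hfull a⟩
  have hI₂ := length_quotient_maximalIdeal_mul I (Ideal.fg_of_isNoetherianRing I)
  have hJ₁ := Ideal.length_quotient_eq_add (m * J) L x fun a => Iff.rfl
  have hJ₂ := length_quotient_maximalIdeal_mul J (Ideal.fg_of_isNoetherianRing J)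
  have fin : ∀ K : Ideal A, m * I ≤ K → Module.length A (A ⧸ K) ≠ ⊤ := fun K hK =>
    ne_top_of_le_ne_top hfin (Ideal.length_quotient_anti hK)
  have h₁ := Ideal.length_quotient_anti hmono
  have h₂ := Ideal.length_quotient_anti hJL
  obtain ⟨i, hi⟩ := ENat.ne_top_iff_exists.1 (fin I Ideal.mul_le_right)
  obtain ⟨j, hj⟩ := ENat.ne_top_iff_exists.1 (fin J (Ideal.mul_le_right.trans hIJ))
  obtain ⟨c, hc⟩ := ENat.ne_top_iff_exists.1 (fin L ((Ideal.mul_le_right.trans hIJ).trans hJL))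
  obtain ⟨p, hp⟩ := ENat.ne_top_iff_exists.1 (fin (Ideal.span {x} ⊔ m * I) le_sup_right)
  obtain ⟨q, hq⟩ := ENat.ne_top_iff_exists.1
    (fin (Ideal.span {x} ⊔ m * J) (hmIJ.trans le_sup_right))
  rw [hI₁, ← hi, ← hp] at hI₂
  rw [hJ₁, ← hc, ← hq, ← hj] at hJ₂
  rw [← hp, ← hq] at h₁
  rw [← hc, ← hj] at h₂
  norm_cast at hI₂ hJ₂ h₁ h₂
  -- The relations read `μ(I) = p`, `c + q = μ(J) + j`, `q ≤ p` and `c ≤ j`. Thus `μ(J) ≤ q ≤ p =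
  -- μ(I) ≤ μ(J)`, which forces `p = q` and `c = j`.
  have hpq : Ideal.span {x} ⊔ m * I = Ideal.span {x} ⊔ m * J := by
    refine Ideal.eq_of_length_quotient_le hmono (fin _ (hmIJ.trans le_sup_right)) ?_
    rw [← hp, ← hq]
    norm_cast
    omega
  have hcj : J = L := by
    refine Ideal.eq_of_length_quotient_le hJL
      (fin L ((Ideal.mul_le_right.trans hIJ).trans hJL)) ?_
    rw [← hc, ← hj]
    norm_cast
    omega
  intro b hb
  have hb' : b ∈ Ideal.span {x} ⊔ m * I := by
    rw [hpq]
    exact Submodule.mem_sup_right hb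
  obtain ⟨y, hy, d, hd, rfl⟩ := Submodule.mem_sup.1 hb'
  obtain ⟨a, rfl⟩ := Ideal.mem_span_singleton.1 hy
  have ha : a ∈ J := by
    rw [hcj]
    change x * a ∈ m * J
    rw [← add_sub_cancel_right (x * a) d]
    exact sub_mem hb (hmIJ hd)
  exact Submodule.add_mem_sup (Ideal.mul_mem_mul (Ideal.mem_span_singleton_self x) ha) hd

end IsLocalRing

end Length

/-! ### The strong Rees property. -/

theorem proposition3p12 {A : Type*} [CommRing A] [IsLocalRing A] [IsNoetherianRing A]
    (hdepth : (AssocGraded.irrelevant (IsLocalRing.maximalIdeal A)).moduleDepth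
      (AssocGraded (IsLocalRing.maximalIdeal A)) = 1)
    (x : AssocGraded.Piece (IsLocalRing.maximalIdeal A) 1)
    (hx : DirectSum.of (AssocGraded.Piece (IsLocalRing.maximalIdeal A)) 1 x ∈
      nonZeroDivisors (AssocGraded (IsLocalRing.maximalIdeal A)))
    (n : ℕ)
    (hsoc : ∀ k < n, AssocGraded.socleComponent (IsLocalRing.maximalIdeal A)
      (DirectSum.of (AssocGraded.Piece (IsLocalRing.maximalIdeal A)) 1 x) k = ⊥)
    (l : ℕ) (hl : 1 ≤ l) (hln : l ≤ n) :
    (IsLocalRing.maximalIdeal A ^ l).HasStrongReesProperty := by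
  obtain ⟨⟨x, hx₁⟩, rfl⟩ := AssocGraded.mk_surjective _ 1 x
  have hxm : x ∈ IsLocalRing.maximalIdeal A := by rwa [pow_one] at hx₁
  have hcancel : ∀ k a, x * a ∈ IsLocalRing.maximalIdeal A ^ (k + 1) →
      a ∈ IsLocalRing.maximalIdeal A ^ k :=
    fun k _ => AssocGraded.mem_pow_of_mul_mem_pow hx₁ hx k
  have hrad : (IsLocalRing.maximalIdeal A ^ l).radical = IsLocalRing.maximalIdeal A := by
    rw [Ideal.radical_pow _ (by omega), (IsLocalRing.maximalIdeal.isMaximal A).isPrime.radical]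
  refine ⟨⟨Ideal.isPrimary_of_isMaximal_radical ?_, hrad⟩, fun J hJ => ?_⟩
  · rw [hrad]
    exact IsLocalRing.maximalIdeal.isMaximal A
  by_contra! hle
  have hmJ := IsLocalRing.maximalIdeal_mul_le_of_spanFinrank_le hxm hJ.le
    (fun a ha => hcancel l a (by rwa [pow_succ']))
    (by rw [← pow_succ']; exact IsLocalRing.length_quotient_maximalIdeal_pow_ne_top _) hle
  rw [← pow_succ'] at hmJ
  have hJk : ∀ k ≤ l, J ≤ IsLocalRing.maximalIdeal A ^ k := by
    intro k hk
    induction k with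
    | zero => simp
    | succ k ih =>
      -- As `k + 1 ≤ l`, the error term `m ^ (l + 1)` lies in `m ^ (k + 2)`, and only socle degrees
      -- `j ≤ k < n` occur.
      refine Ideal.le_pow_succ_of_mul_le hxm hcancel k (fun j hj a ha hann => ?_) J
        (ih (by omega)) (hmJ.trans (sup_le_sup_left (Ideal.pow_le_pow_right (by omega)) _))
      exact AssocGraded.mem_span_sup_of_socleComponent_eq_bot hx₁ hx
        (hsoc j (by omega)) ha hann
  exact hJ.not_ge (hJk l le_rfl)
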